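/- Link diagrams are diagrams on the sphere; for a diagram $D$, $c(D)$ is its number of crossings and $\det(D)$ the determinant $|V(-1)|$ ($V$ the Jones polynomial) of the link it represents. A link is quasi-alternating if it belongs to the smallest class of links which contains the unknot and which contains the link of a diagram $D$ whenever $D$ has a crossing $c$ such that the links of both smoothings of $D$ at $c$ are in the class and $\det(D)$ is the sum of their determinants. Let $D$ be an almost alternating link diagram with dealternator $c$ (that is, changing the crossing $c$ makes $D$ alternating), and mark the ends of $c$ as $NW, SW, SE, NE$ so that $c$ is the elementary tangle $-1$ (overstrand of negative slope). Let $D^c_0$ and $D^c_\infty$ be the diagrams obtained by replacing $c$ by the tangles $0$ (arcs $NW$–$NE$ and $SW$–$SE$) and $\infty$ (arcs $NW$–$SW$ and $NE$–$SE$). Suppose that $D$ represents a quasi-alternating link and that $c(D)\le\det(D)$. Then $\det(D^c_0)\ne\det(D^c_\infty)$. Put $\omega=-\tfrac12$ if $\det(D^c_0)>\det(D^c_\infty)$ and $\omega=-2$ if $\det(D^c_0)<\det(D^c_\infty)$, and let $D^{c\leftarrow\omega}$ be the dealternator extension of $D$, i.e. the diagram obtained by replacing $c$ by the vertical ($\omega=-\frac12$)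 or horizontal ($\omega=-2$) twist of two crossings of type $-1$. Let $d$ be either of these two crossings, and let $\mathcal D$ be any rational extension of $D^{c\leftarrow\omega}$ at $d$, that is, the diagram obtained by replacing $d$ by the standard diagram of a rational tangle $[-a_1,\dots,-a_n]=-\bigl(a_1+\tfrac{1}{a_2+\cdots+\frac1{a_n}}\bigr)$ with integers $n\ge1$, $a_1\ge0$, $a_2,\dots,a_n\ge1$, and $a_1\geq 1$ if $n=1$. Then $c(\mathcal D)\le\det(\mathcal D)$. -/

import Mathlib

noncomputable section

/-- The number of orbits of the permutation group generated by `S`. -/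
def numOrbits {α : Type} (S : Set (Equiv.Perm α)) : ℕ :=
  Nat.card (MulAction.orbitRel.Quotient (Subgroup.closure S) α)

/-- The two crossingless elementary tangles. The endpoints of a tangle are numbered
counterclockwise: `0 = NW`, `1 = SW`, `2 = SE`, `3 = NE`. The tangle `0` consists of the arcs
`NW-NE` and `SW-SE`, the tangle `∞` of the arcs `NW-SW` and `SE-NE`. -/
inductive Smoothing : Type
  | zero
  | infty
  deriving DecidableEq

instance : Fintype Smoothing := ⟨{.zero, .infty}, by intro x; cases x <;> simp⟩

/-- The arcs of a smoothing, as an involution of the four endpoints. -/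
def Smoothing.arc : Smoothing → Equiv.Perm (Fin 4)
  | .zero => Equiv.subLeft 3
  | .infty => Equiv.subLeft 1

theorem Smoothing.arc_arc : ∀ (s : Smoothing) (i : Fin 4), s.arc (s.arc i) = i
  | .zero => by decide
  | .infty => by decide

theorem Smoothing.arc_ne : ∀ (s : Smoothing) (i : Fin 4), s.arc i ≠ i
  | .zero => by decide
  | .infty => by decide

/-- The elementary tangles `0`, `∞`, `1`, `-1`. In `pos = 1` the overstrand is `SW-NE`
(positive slope), in `neg = -1` it is `NW-SE` (negative slope). -/
inductive Elementary : Type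
  | smoothed (s : Smoothing)
  | pos
  | neg

namespace Elementary

def IsCrossing : Elementary → Prop
  | smoothed _ => False
  | pos => True
  | neg => True

/-- Whether the endpoint `i` of a crossing belongs to its overstrand. -/
def isOver : Elementary → Fin 4 → Bool
  | smoothed _, _ => false
  | pos, i => decide (i = 1 ∨ i = 3)
  | neg, i => decide (i = 0 ∨ i = 2)

/-- The crossing change. -/
def change : Elementary → Elementary
  | smoothed s => smoothed s
  | pos => neg
  | neg => pos

/-- The arcs of the tangle which do not run through a crossing. -/
def arc : Elementary → Equiv.Perm (Fin 4)
  | smoothed s => s.arc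
  | pos => 1
  | neg => 1

/-- The coefficient of the smoothing `s` in the Kauffman bracket of an elementary tangle. The
`A`-smoothing of a crossing joins the two regions which are swept out when the overstrand is
turned counterclockwise: this is `∞` for the crossing `1` and `0` for the crossing `-1`. -/
def weight (A : ℂ) : Elementary → Smoothing → ℂ
  | smoothed t, s => if s = t then 1 else 0
  | pos, .infty => A
  | pos, .zero => A⁻¹
  | neg, .zero => A
  | neg, .infty => A⁻¹

end Elementary

/-- Counterclockwise rotation by one step around each vertex. -/
def rot (V : Type) : Equiv.Perm (V × Fin 4) :=
  Equiv.prodCongr (Equiv.refl V) (Equiv.addRight 1)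

/-- An unoriented link diagram on an oriented surface, as a combinatorial 4-valent map. At every
vertex `v` there is a small disk whose four endpoints `(v, 0), ..., (v, 3)`, in counterclockwise
order, are the ends of edges; `glue` exchanges the two ends of every edge, and the disk is filled
with the elementary tangle `kind v`. So the crossings of the diagram are the vertices of kind
`±1`; a vertex of kind `0` or `∞` only records two arcs of the diagram passing by each other.
The numbering at a vertex is the marking of the disk as a tangle. -/
structure LinkDiagram : Type 1 where
  V : Type
  [fintypeV : Fintype V]
  [decEqV : DecidableEq V]
  glue : Equiv.Perm (V × Fin 4)
  glue_glue : ∀ d, glue (glue d) = d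
  glue_ne : ∀ d, glue d ≠ d
  kind : V → Elementary

attribute [instance] LinkDiagram.fintypeV LinkDiagram.decEqV

namespace LinkDiagram

variable (D : LinkDiagram)

/-- The ends of the edges of the underlying map. -/
abbrev Dart : Type := D.V × Fin 4

/-- The underlying map lies on a disjoint union of spheres, one for each connected component:
`#vertices - #edges + #faces = 2 * #components`, where `#edges = 2 * #vertices`. -/
def Planar : Prop :=
  numOrbits {rot D.V * D.glue} = Fintype.card D.V + 2 * numOrbits {rot D.V, D.glue}

/-- The crossings of the diagram. -/
abbrev Cr : Type := {v : D.V // (D.kind v).IsCrossing}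

/-- The number `c(D)` of crossings of the diagram. -/
def crossingNumber : ℕ := Nat.card D.Cr

/-- Replace the tangle at the vertex `v` by the elementary tangle `k`. -/
def setKind (v : D.V) (k : Elementary) : LinkDiagram :=
  { D with kind := Function.update D.kind v k }

/-- The smoothings `D^v_0` and `D^v_∞`. -/
def smooth (v : D.V) (s : Smoothing) : LinkDiagram := D.setKind v (.smoothed s)

def crossingChange (v : D.V) : LinkDiagram := D.setKind v (D.kind v).change

/-- Reattach the ends of the edges to the vertices according to `τ`. -/
def reattach (τ : Equiv.Perm D.Dart) : LinkDiagram :=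
  { D with
    glue := τ * D.glue * τ⁻¹
    glue_glue := by intro d; simp [D.glue_glue]
    glue_ne := by
      intro d h
      apply D.glue_ne (τ⁻¹ d)
      apply τ.injective
      simpa using h }

/-! ### The determinant -/

/-- The number of circles of the state in which every vertex `v` carries the smoothing `s v`. -/
def circlesOfState (s : D.V → Smoothing) : ℕ :=
  numOrbits {D.glue, Equiv.prodShear (Equiv.refl D.V) (fun v => (s v).arc)}

/-- The Kauffman bracket, normalised to be `1` on a circle, as a function of `A`. -/
def kauffmanBracket (A : ℂ) : ℂ :=
  ∑ s : D.V → Smoothing,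
    (∏ v, (D.kind v).weight A (s v)) * (-A ^ 2 - A⁻¹ ^ 2) ^ (D.circlesOfState s - 1)

/-- The determinant `|V(-1)|`, where `V` is the Jones polynomial, in the variable `t = A⁻⁴`. At
`A = exp (iπ/4)`, where `t = -1`, the Jones polynomial is the Kauffman bracket up to a power
of `-A³`, which has absolute value `1`. -/
def det : ℝ := ‖D.kauffmanBracket (Complex.exp (Real.pi / 4 * Complex.I))‖

/-! ### Alternating and almost alternating diagrams -/

/-- Along every strand the over- and undercrossings alternate: the ends of the edges can be
labelled over (`true`) or under (`false`), correctly at the crossings, so that the label changes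
along every edge and along every arc passing through a vertex that is not a crossing. -/
def Alternating : Prop :=
  ∃ o : D.Dart → Bool,
    (∀ d, o (D.glue d) = !o d) ∧
    (∀ v i, (D.kind v).IsCrossing → o (v, i) = (D.kind v).isOver i) ∧
    (∀ v i s, D.kind v = .smoothed s → o (v, s.arc i) = !o (v, i))

/-- `c` is a dealternator: a crossing whose change makes the diagram alternating (so that the
diagram is almost alternating). -/
def IsDealternator (c : D.V) : Prop :=
  (D.kind c).IsCrossing ∧ (D.crossingChange c).Alternating

/-! ### Links: diagrams up to planar isotopy and Reidemeister moves -/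

/-- The group of permutations whose orbits are the arcs of the diagram between crossings, and
the circles without crossings. -/
def arcGroup : Subgroup (Equiv.Perm D.Dart) :=
  Subgroup.closure {D.glue, Equiv.prodShear (Equiv.refl D.V) (fun v => (D.kind v).arc)}

/-- The two ends of edges belong to the same arc of the diagram between crossings. -/
def SameArc (d e : D.Dart) : Prop := e ∈ MulAction.orbit D.arcGroup d

/-- The number of components of the diagram without crossings. -/
def freeCircles : ℕ :=
  Set.ncard {O : Set D.Dart | (∃ d, O = MulAction.orbit D.arcGroup d) ∧
    ∀ e ∈ O, ¬ (D.kind e.1).IsCrossing}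

/-- Two planar diagrams which differ only by vertices that are not crossings and by the
numbering at the vertices: a bijection between the crossings, with a rotation at each of
them, respects over and under and the arcs between the crossings, and there are equally many
circles without crossings. -/
def Isotopic (D E : LinkDiagram) : Prop :=
  D.Planar ∧ E.Planar ∧ D.freeCircles = E.freeCircles ∧
  ∃ f : (D.Cr × Fin 4) ≃ (E.Cr × Fin 4),
    (∀ d, f (rot D.Cr d) = rot E.Cr (f d)) ∧
    (∀ d, (D.kind d.1.1).isOver d.2 = (E.kind (f d).1.1).isOver (f d).2) ∧
    (∀ d e, D.SameArc (d.1.1, d.2) (e.1.1, e.2) ↔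
      E.SameArc ((f d).1.1, (f d).2) ((f e).1.1, (f e).2))

/-- Moving each of the three strands of a triangle with vertices `v k` across the opposite
vertex. The strand through `v k` and `v (k + 1)` enters `v k` at its end `i k + 2`, leaves it at
`i k`, enters `v (k + 1)` at `i (k + 1) + 1` and leaves it at `i (k + 1) + 3`; after the move it
passes, in the same direction, through `v (k + 1)` first. -/
def triangleSwap (v : Fin 3 → D.V) (i : Fin 3 → Fin 4) : Equiv.Perm D.Dart :=
  let σ : Fin 3 → Equiv.Perm D.Dart := fun k =>
    Equiv.swap (v k, i k + 2) (v (k + 1), i (k + 1) + 1) *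
      Equiv.swap (v k, i k) (v (k + 1), i (k + 1) + 3)
  σ 0 * σ 1 * σ 2

/-- Planar isotopies and Reidemeister moves. A face with the corners `(v k, i k, i k + 1)`,
in counterclockwise order, is given by `glue (v k, i k) = (v (k + 1), i (k + 1) + 1)`. -/
inductive Move : LinkDiagram → LinkDiagram → Prop
  | isotopy {D E : LinkDiagram} (h : Isotopic D E) : Move D E
  /-- A crossing with a monogon is replaced by an uncrossed arc. -/
  | r1 {D : LinkDiagram} (hD : D.Planar) (v : D.V) (i : Fin 4) (s : Smoothing)
      (hv : (D.kind v).IsCrossing) (hface : D.glue (v, i) = (v, i + 1))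
      (hs : s.arc i = i + 3) : Move D (D.smooth v s)
  /-- Two crossings with a bigon, one side of which is over at both ends (or under at
  both ends), are replaced by two uncrossed arcs. -/
  | r2 {D : LinkDiagram} (hD : D.Planar) (v w : D.V) (i j : Fin 4) (s t : Smoothing)
      (hvw : v ≠ w) (hv : (D.kind v).IsCrossing) (hw : (D.kind w).IsCrossing)
      (hface₁ : D.glue (v, i) = (w, j + 1)) (hface₂ : D.glue (w, j) = (v, i + 1))
      (hover : (D.kind v).isOver i = (D.kind w).isOver (j + 1))
      (hs : s.arc i = i + 3) (ht : t.arc j = j + 3) :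
      Move D ((D.smooth v s).smooth w t)
  /-- The three strands of a triangle, one of which is over both others, are moved across. -/
  | r3 {D : LinkDiagram} (hD : D.Planar) (v : Fin 3 → D.V) (i : Fin 3 → Fin 4)
      (hinj : Function.Injective v) (hv : ∀ k, (D.kind (v k)).IsCrossing)
      (hface : ∀ k, D.glue (v k, i k) = (v (k + 1), i (k + 1) + 1))
      (htop₁ : (D.kind (v 0)).isOver (i 0) = true)
      (htop₂ : (D.kind (v 1)).isOver (i 1 + 1) = true) :
      Move D (D.reattach (D.triangleSwap v i))

/-- The diagrams represent the same link. -/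
def SameLink : LinkDiagram → LinkDiagram → Prop := Relation.EqvGen Move

/-- A circle. -/
def circle : LinkDiagram where
  V := Unit
  glue := Equiv.prodCongr (Equiv.refl Unit) (Equiv.subLeft 1)
  glue_glue := by decide
  glue_ne := by decide
  kind := fun _ => .smoothed .zero

/-- The diagram represents a quasi-alternating link: the smallest class of links which contains
the unknot, and contains the link of a diagram `D` as soon as, for some crossing `c` of `D`, it
contains the links of both smoothings of `D` at `c` and `det D` is the sum of their
determinants. -/
inductive QuasiAlternating : LinkDiagram → Prop
  | unknot : QuasiAlternating circle
  | sameLink {D E : LinkDiagram} (h : SameLink D E) (hD : QuasiAlternating D) :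
      QuasiAlternating E
  | step {D : LinkDiagram} (hD : D.Planar) (c : D.V) (hc : (D.kind c).IsCrossing)
      (h₀ : QuasiAlternating (D.smooth c .zero)) (h₁ : QuasiAlternating (D.smooth c .infty))
      (hdet : D.det = (D.smooth c .zero).det + (D.smooth c .infty).det) : QuasiAlternating D

/-! ### Rational extensions -/

/-- The directions of tangle addition: side by side, and one above the other. -/
inductive Direction : Type
  | horizontal
  | vertical

def Direction.other : Direction → Direction
  | .horizontal => .vertical
  | .vertical => .horizontal

/-- Add a separate component with a single vertex, called `none`, of kind `k`, whose
four ends are glued like the arcs of `s`. -/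
def addVertex (s : Smoothing) (k : Elementary) : LinkDiagram where
  V := Option D.V
  glue := Function.Involutive.toPerm
    (fun d : Option D.V × Fin 4 =>
      match d with
      | (some v, i) => (some (D.glue (v, i)).1, (D.glue (v, i)).2)
      | (none, i) => (none, s.arc i))
    (by
      rintro ⟨_ | v, i⟩
      · simp [s.arc_arc]
      · simp [D.glue_glue])
  glue_glue := by
    rintro ⟨_ | v, i⟩
    · simp [Function.Involutive.toPerm, s.arc_arc]
    · simp [Function.Involutive.toPerm, D.glue_glue]
  glue_ne := by
    rintro ⟨_ | v, i⟩
    · simpa [Function.Involutive.toPerm] using s.arc_ne i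
    · have h := D.glue_ne (v, i)
      simpa [Function.Involutive.toPerm, Prod.ext_iff] using h
  kind := fun v => v.elim k D.kind

/-- Replace the tangle `t` at the vertex `c` by `t + ε` (horizontal) or by `t * ε` (vertical),
where `ε` is a new crossing, called `none`, of the same kind as `c`. Horizontally, the new crossing
is on the right: its ends `0, 1` (`NW, SW`) are joined to the ends `3, 2` (`NE, SE`) of `c`,
and its ends `3, 2` take the place of the ends `3, 2` of `c`. Vertically, the new crossing is at
the bottom: its ends `0, 3` (`NW, NE`) are joined to the ends `1, 2` (`SW, SE`) of `c`, and its
ends `1, 2` take the place of the ends `1, 2` of `c`. -/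
def twist (c : D.V) : Direction → LinkDiagram
  | .horizontal => (D.addVertex .zero (D.kind c)).reattach
      (Equiv.swap ((some c : Option D.V), (3 : Fin 4)) (none, 3) *
        Equiv.swap ((some c : Option D.V), (2 : Fin 4)) (none, 2))
  | .vertical => (D.addVertex .infty (D.kind c)).reattach
      (Equiv.swap ((some c : Option D.V), (1 : Fin 4)) (none, 1) *
        Equiv.swap ((some c : Option D.V), (2 : Fin 4)) (none, 2))

/-- The crossing `c` that remains after `twist`, at the left or at the top. -/
def oldCrossing (c : D.V) : (r : Direction) → (D.twist c r).V
  | .horizontal => (some c : Option D.V)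
  | .vertical => (some c : Option D.V)

/-- The crossing that is added by `twist`, at the right or at the bottom. -/
def newCrossing (c : D.V) : (r : Direction) → (D.twist c r).V
  | .horizontal => (none : Option D.V)
  | .vertical => (none : Option D.V)

/-- One twist at the marked crossing, which remains marked. -/
def twistStep (r : Direction) (p : Σ D : LinkDiagram, D.V) : Σ D : LinkDiagram, D.V :=
  ⟨p.1.twist p.2 r, p.1.oldCrossing p.2 r⟩

/-- Replace the marked crossing, of sign `ε`, by the standard diagram of the rational tangle
`[ε a₁, ε a₂, ..., ε aₙ]`, that is `ε (a₁ + 1 / (a₂ + 1 / (... + 1 / aₙ)))`. It is built from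
the outside: `a₁` crossings in the direction `r`, then `a₂` crossings in the other direction, and
so on; the marked crossing is the innermost of the last `aₙ` crossings. -/
def insertTangle : Direction → List ℕ → (Σ D : LinkDiagram, D.V) → Σ D : LinkDiagram, D.V
  | _, [], p => p
  | r, [a], p => (twistStep r)^[a - 1] p
  | r, a :: b :: l, p => insertTangle r.other (b :: l) ((twistStep r)^[a] p)

/-- The rational extension of `D` at the crossing `c` with the tangle `[ε a₁, ..., ε aₙ]`, where
`ε` is the sign of `c`. -/
def rationalExtension (c : D.V) (a : List ℕ) : LinkDiagram :=
  (insertTangle .horizontal a ⟨D, c⟩).1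

/-- `[ε a₁, ..., ε aₙ]` extends a crossing of sign `ε`: all `aᵢ` are positive, except that `a₁`
may be `0` when `n ≥ 2` (so that `ε/2 = [0, 2ε]` is allowed). -/
def IsExtensionTuple (a : List ℕ) : Prop :=
  a ≠ [] ∧ a ≠ [0] ∧ ∀ x ∈ a.tail, 1 ≤ x

/-- For a crossing `c` of sign `ε`, the diagram `D.twist c .horizontal` is the rational
extension with `[2ε]`, the diagram `D.twist c .vertical` the one with `[0, 2ε] = ε/2`. -/
theorem rationalExtension_two (c : D.V) :
    D.rationalExtension c [2] = D.twist c .horizontal := rfl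

theorem rationalExtension_zero_two (c : D.V) :
    D.rationalExtension c [0, 2] = D.twist c .vertical := rfl

end LinkDiagram

end

noncomputable section

open Module

/-! ### Orbits and invariant functions -/

/-! At `A = exp (iπ/4)` the value `-A² - A⁻²` of a circle is `0`, so the determinant only sees the
states with a single circle.

In a planar alternating diagram all these states have the same weight (`Alternating.exists_weight`).
The over/under labels colour the faces like a checkerboard. A single circle forces the faces of one
colour to be connected through the smoothings which join them, so their number is at most one more
than the number of such smoothings. Over both colours this bounds the number of faces by the number
of crossings plus `2`, and Euler's formula gives the reverse inequality. So both bounds are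
equalities, and the numbers of `A`- and `B`-smoothings depend only on the diagram.

At a dealternator let `m`, `n` count the contributing one-circle states of the two smoothings.
Dividing the common weight by that of the changed crossing gives the brackets `A W m` and `A⁻¹ W n`
with `‖W‖ = 1`. So `m`, `n` are the determinants of the smoothings, the bracket of `D` is `i W (m -
n)`, and `1 ≤ c(D) ≤ |m - n|` excludes `m = n`. In the twist chosen by the larger determinant, the
smoothings of either crossing have the determinants `m, m - n` (or `n - m, n`), with phases for
which they add up (`coherent_twisted`).

At such a crossing with values `x, y ≥ 1` a further twist leads to `x + y, y` or `x, x + y`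
(`Coherent.twisted_horizontal`, `Coherent.twisted_vertical`). It adds one crossing and at least `1`
to the determinant `x + y`, so the inequality persists through every rational extension (`Bounded`).
-/

/-- The functions which are invariant under a set of permutations. -/
def invariantFunctions {α : Type} (S : Set (Equiv.Perm α)) : Submodule ℚ (α → ℚ) where
  carrier := {f | ∀ g ∈ S, ∀ x, f (g x) = f x}
  add_mem' hf hg σ hσ x := by simp [hf σ hσ x, hg σ hσ x]
  zero_mem' _ _ _ := rfl
  smul_mem' a f hf σ hσ x := by simp [hf σ hσ x]

theorem mem_invariantFunctions {α : Type} {S : Set (Equiv.Perm α)} {f : α → ℚ} :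
    f ∈ invariantFunctions S ↔ ∀ g ∈ S, ∀ x, f (g x) = f x := Iff.rfl

theorem invariantFunctions_apply_of_mem_closure {α : Type} {S : Set (Equiv.Perm α)} {f : α → ℚ}
    (hf : f ∈ invariantFunctions S) {g : Equiv.Perm α} (hg : g ∈ Subgroup.closure S) :
    ∀ x, f (g x) = f x := by
  induction hg using Subgroup.closure_induction with
  | mem g hg => exact hf g hg
  | one => simp
  | mul a b _ _ ha hb => intro x; rw [Equiv.Perm.mul_apply, ha, hb]
  | inv a _ ha => intro x; rw [← ha, ← Equiv.Perm.mul_apply, mul_inv_cancel, Equiv.Perm.one_apply]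

theorem range_funLeft_orbits {α : Type} (S : Set (Equiv.Perm α)) :
    LinearMap.range (LinearMap.funLeft ℚ ℚ
      (Quotient.mk (MulAction.orbitRel (Subgroup.closure S) α))) = invariantFunctions S := by
  ext f
  constructor
  · rintro ⟨h, rfl⟩ g hg x
    simp only [LinearMap.funLeft_apply]
    congr 1
    exact Quotient.sound ⟨⟨g, Subgroup.subset_closure hg⟩, rfl⟩
  · intro hf
    refine ⟨Quotient.lift f ?_, ?_⟩
    · rintro a b ⟨g, rfl⟩
      exact invariantFunctions_apply_of_mem_closure hf g.2 b
    · ext x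
      rfl

/-- With orbits counted as a dimension, merging orbits becomes imposing linear conditions. -/
theorem finrank_invariantFunctions {α : Type} [Finite α] (S : Set (Equiv.Perm α)) :
    finrank ℚ (invariantFunctions S) = numOrbits S := by
  classical
  have : Finite (MulAction.orbitRel.Quotient (Subgroup.closure S) α) := Quotient.finite _
  have := Fintype.ofFinite (MulAction.orbitRel.Quotient (Subgroup.closure S) α)
  rw [← range_funLeft_orbits, LinearMap.finrank_range_of_inj
    (LinearMap.funLeft_injective_of_surjective _ _ _ Quotient.mk_surjective)]
  exact (Module.finrank_fintype_fun_eq_card ℚ).trans Nat.card_eq_fintype_card.symm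

theorem numOrbits_le_one_iff {α : Type} [Finite α] (S : Set (Equiv.Perm α)) :
    numOrbits S ≤ 1 ↔ ∀ f ∈ invariantFunctions S, ∀ x y, f x = f y := by
  classical
  have hfin : Finite (MulAction.orbitRel.Quotient (Subgroup.closure S) α) := Quotient.finite _
  rw [numOrbits, Finite.card_le_one_iff_subsingleton]
  constructor
  · intro h f hf x y
    rw [← range_funLeft_orbits] at hf
    obtain ⟨g, rfl⟩ := hf
    simp only [LinearMap.funLeft_apply]
    congr 1
    exact h.elim _ _
  · refine fun h => ⟨fun p q => ?_⟩
    induction p using Quotient.inductionOn with | _ x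
    induction q using Quotient.inductionOn with | _ y
    by_contra hne
    have := h _ ((range_funLeft_orbits S) ▸ LinearMap.mem_range_self _
      (Pi.single (Quotient.mk _ x) 1)) x y
    simp only [LinearMap.funLeft_apply, Pi.single_eq_same] at this
    rw [Pi.single_eq_of_ne (Ne.symm hne)] at this
    exact one_ne_zero this

theorem numOrbits_pos {α : Type} [Finite α] [Nonempty α] (S : Set (Equiv.Perm α)) :
    0 < numOrbits S := by
  have hfin : Finite (MulAction.orbitRel.Quotient (Subgroup.closure S) α) := Quotient.finite _
  have : Nonempty (MulAction.orbitRel.Quotient (Subgroup.closure S) α) :=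
    ⟨Quotient.mk _ (Classical.arbitrary α)⟩
  exact Nat.card_pos

/-- Imposing `#K` linear conditions lowers the dimension by at most `#K`. -/
theorem finrank_le_finrank_add_card {E ι : Type*} [AddCommGroup E] [Module ℚ E]
    [FiniteDimensional ℚ E] (P Q : Submodule ℚ E) (K : Finset ι) (l : ι → E →ₗ[ℚ] ℚ)
    (h : ∀ f ∈ P, (∀ j ∈ K, l j f = 0) → f ∈ Q) :
    finrank ℚ P ≤ finrank ℚ Q + K.card := by
  let L : P →ₗ[ℚ] (K → ℚ) := LinearMap.pi fun j => (l j).comp P.subtype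
  have h₁ := L.finrank_range_add_finrank_ker
  have h₂ : finrank ℚ (LinearMap.range L) ≤ K.card := by
    simpa using Submodule.finrank_le (LinearMap.range L)
  have h₃ : finrank ℚ (LinearMap.ker L) ≤ finrank ℚ Q := by
    rw [← LinearMap.finrank_range_of_inj (f := P.subtype.comp (LinearMap.ker L).subtype)
      (P.subtype_injective.comp (LinearMap.ker L).subtype_injective)]
    apply Submodule.finrank_mono
    rintro _ ⟨f, rfl⟩
    refine h _ f.1.2 fun j hj => ?_
    exact congrFun (LinearMap.mem_ker.1 f.2) ⟨j, hj⟩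
  omega

/-! ### States of alternating diagrams -/

namespace Elementary

/-- Whether a smoothing is the `A`-smoothing of an elementary tangle. -/
def isA : Elementary → Smoothing → Bool
  | neg, .zero => true
  | pos, .infty => true
  | _, _ => false

/-- Whether a smoothing is the `B`-smoothing of an elementary tangle. -/
def isB : Elementary → Smoothing → Bool
  | neg, .infty => true
  | pos, .zero => true
  | _, _ => false

/-- The way a face runs through an elementary tangle: along the arcs, or around the corners of
a crossing. -/
def turn : Elementary → Fin 4 → Fin 4
  | smoothed s, i => s.arc i
  | pos, i => i + 1
  | neg, i => i + 1

/-- The bracket coefficient of a smoothing is determined by its type. -/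
theorem weight_eq (A : ℂ) (k : Elementary) (s : Smoothing) (h : ∀ t, k = smoothed t → s = t) :
    k.weight A s = (if k.isB s then A⁻¹ else 1) * (if k.isA s then A else 1) := by
  cases k <;> cases s <;> simp_all [weight, isA, isB]

theorem isOver_arc (k : Elementary) (hk : k.IsCrossing) (s : Smoothing) (i : Fin 4) :
    k.isOver (s.arc i) = !k.isOver i := by
  revert i
  cases k <;> cases s <;> first | exact hk.elim | decide

end Elementary

namespace LinkDiagram

variable (D : LinkDiagram)

/-- The difference of the values at the ends `i` and `j` of a vertex. -/
def endDifference (v : D.V) (i j : Fin 4) : (D.Dart → ℚ) →ₗ[ℚ] ℚ :=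
  LinearMap.proj (R := ℚ) (φ := fun _ : D.Dart => ℚ) (v, i) - LinearMap.proj (v, j)

theorem endDifference_apply (v : D.V) (i j : Fin 4) (f : D.Dart → ℚ) :
    D.endDifference v i j f = f (v, i) - f (v, j) := rfl

/-- In this form states of different diagrams can be compared by transporting functions. -/
theorem circlesOfState_le_one_iff (s : D.V → Smoothing) :
    D.circlesOfState s ≤ 1 ↔ ∀ f : D.Dart → ℚ, (∀ d, f (D.glue d) = f d) →
      (∀ v i, f (v, (s v).arc i) = f (v, i)) → ∀ x y, f x = f y := by
  rw [circlesOfState, numOrbits_le_one_iff]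
  refine forall_congr' fun f => ?_
  simp only [mem_invariantFunctions, Set.mem_insert_iff, Set.mem_singleton_iff,
    forall_eq_or_imp, forall_eq, Prod.forall, and_imp]
  rfl

/-! ### Faces, their checkerboard colouring and Euler's formula -/

/-- The functions which are constant along the faces of the diagram. -/
def faceFunctions : Submodule ℚ (D.Dart → ℚ) where
  carrier := {f | ∀ d, f ((D.glue d).1, (D.kind (D.glue d).1).turn (D.glue d).2) = f d}
  add_mem' hf hg d := by simp only [Pi.add_apply, hf d, hg d]
  zero_mem' _ := rfl
  smul_mem' a f hf d := by simp only [Pi.smul_apply, hf d]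

/-- The functions on the faces which are supported on the darts with the label `b`. -/
def coloredFaceFunctions (o : D.Dart → Bool) (b : Bool) : Submodule ℚ (D.Dart → ℚ) where
  carrier := {f | f ∈ D.faceFunctions ∧ ∀ d, o d ≠ b → f d = 0}
  add_mem' hf hg := ⟨add_mem hf.1 hg.1, fun d hd => by simp [hf.2 d hd, hg.2 d hd]⟩
  zero_mem' := ⟨zero_mem _, fun _ _ => rfl⟩
  smul_mem' a f hf := ⟨Submodule.smul_mem _ a hf.1, fun d hd => by simp [hf.2 d hd]⟩

open Classical in
/-- Planarity, in the form of a lower bound for the number of faces. -/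
theorem card_add_two_le_finrank_faceFunctions [Nonempty D.V] (hD : D.Planar) :
    Fintype.card D.V + 2 ≤ finrank ℚ D.faceFunctions +
      (Finset.univ.filter fun v => ¬ (D.kind v).IsCrossing).card := by
  -- Faces minus vertices is twice the number of components, of which there is at least one.
  have h₁ : Fintype.card D.V + 2 ≤
      finrank ℚ (invariantFunctions {rot D.V * D.glue}) := by
    rw [finrank_invariantFunctions, hD]
    have := numOrbits_pos ({rot D.V, D.glue} : Set (Equiv.Perm D.Dart))
    omega
  refine h₁.trans ?_
  -- Resolving a vertex that is not a crossing merges the faces at two opposite corners, at the cost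
  -- of one condition; the walk at the other two ends is unchanged.
  refine finrank_le_finrank_add_card _ _ _
    (fun v => if D.kind v = .smoothed .zero
      then D.endDifference v 1 3 else D.endDifference v 0 2) ?_
  intro f hf hK d
  have hrot : f ((D.glue d).1, (D.glue d).2 + 1) = f d := hf _ rfl d
  rw [← hrot]
  generalize D.glue d = e
  obtain ⟨v, i⟩ := e
  have hv := hK v
  simp only [Finset.mem_filter, Finset.mem_univ, true_and] at hv
  rcases hk : D.kind v with (_ | _) | _ | _
  · have := hv (by simp [hk, Elementary.IsCrossing])
    simp [hk, endDifference_apply, sub_eq_zero] at this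
    fin_cases i <;> simp [Elementary.turn, Smoothing.arc, this]
  · have := hv (by simp [hk, Elementary.IsCrossing])
    simp [hk, endDifference_apply, sub_eq_zero] at this
    fin_cases i <;> simp [Elementary.turn, Smoothing.arc, this]
  · rfl
  · rfl

variable {D}

/-- The label changes along an edge, and again around a corner of a crossing or along an arc of a
smoothing; so it is constant on each face. -/
theorem turn_label {o : D.Dart → Bool} (ho₁ : ∀ d, o (D.glue d) = !o d)
    (ho₂ : ∀ v i, (D.kind v).IsCrossing → o (v, i) = (D.kind v).isOver i)
    (ho₃ : ∀ v i s, D.kind v = .smoothed s → o (v, s.arc i) = !o (v, i)) (d : D.Dart) :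
    o ((D.glue d).1, (D.kind (D.glue d).1).turn (D.glue d).2) = o d := by
  rw [← Bool.not_not (o d), ← ho₁]
  generalize D.glue d = e
  obtain ⟨v, i⟩ := e
  have h₂ := ho₂ v
  rcases hk : D.kind v with s | _ | _
  · exact ho₃ v i s hk
  · simp only [hk, Elementary.IsCrossing, forall_const] at h₂
    simp only [Elementary.turn, h₂]
    revert i; decide
  · simp only [hk, Elementary.IsCrossing, forall_const] at h₂
    simp only [Elementary.turn, h₂]
    revert i; decide

/-- Cutting a face function off to one colour leaves a face function. -/
theorem finrank_faceFunctions_le {o : D.Dart → Bool} (ho₁ : ∀ d, o (D.glue d) = !o d)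
    (ho₂ : ∀ v i, (D.kind v).IsCrossing → o (v, i) = (D.kind v).isOver i)
    (ho₃ : ∀ v i s, D.kind v = .smoothed s → o (v, s.arc i) = !o (v, i)) :
    finrank ℚ D.faceFunctions ≤ finrank ℚ (D.coloredFaceFunctions o true) +
      finrank ℚ (D.coloredFaceFunctions o false) := by
  refine le_trans (Submodule.finrank_mono ?_)
    (Submodule.finrank_add_le_finrank_add_finrank _ _)
  intro f hf
  have key : ∀ b, (fun d => if o d = b then f d else 0) ∈ D.coloredFaceFunctions o b := by
    refine fun b => ⟨fun d => ?_, fun d hd => if_neg hd⟩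
    simp only [turn_label ho₁ ho₂ ho₃, hf d]
  refine Submodule.mem_sup.2 ⟨_, key true, _, key false, ?_⟩
  ext d
  cases h : o d <;> simp [h]

/-- The crossings at which a state turns away from the faces with the label `b`. -/
def badCrossings (D : LinkDiagram) (s : D.V → Smoothing) (b : Bool) : Finset D.V :=
  Finset.univ.filter fun v => (bif b then (D.kind v).isB (s v) else (D.kind v).isA (s v)) = true

/-- At a good crossing the circle of `s` follows the corners of the faces labelled `b`; at a bad one
it joins the two faces, and one condition equates their values. Then `f` is constant along the only
circle. -/
theorem finrank_coloredFaceFunctions_le {o : D.Dart → Bool} (ho₁ : ∀ d, o (D.glue d) = !o d)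
    (ho₂ : ∀ v i, (D.kind v).IsCrossing → o (v, i) = (D.kind v).isOver i)
    (ho₃ : ∀ v i s, D.kind v = .smoothed s → o (v, s.arc i) = !o (v, i))
    (s : D.V → Smoothing) (hs : D.circlesOfState s ≤ 1)
    (hk : ∀ v t, D.kind v = .smoothed t → s v = t) (b : Bool) :
    finrank ℚ (D.coloredFaceFunctions o b) ≤ 1 + (D.badCrossings s b).card := by
  classical
  refine le_trans (finrank_le_finrank_add_card _
    (Submodule.span ℚ {fun d => if o d = b then (1 : ℚ) else 0}) (D.badCrossings s b)
    -- Only one of the two opposite pairs of ends has the label `b`; the other difference vanishes.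
    -- The sum thus serves both signs of crossings.
    (fun v => D.endDifference v 0 2 + D.endDifference v 1 3) ?_) ?_
  swap
  · gcongr
    simpa using finrank_span_le_card (R := ℚ) {fun d => if o d = b then (1 : ℚ) else 0}
  intro f hf hK
  have oarc : ∀ v i, o (v, (s v).arc i) = !o (v, i) := by
    intro v i
    by_cases hv : (D.kind v).IsCrossing
    · rw [ho₂ v _ hv, ho₂ v _ hv, Elementary.isOver_arc _ hv]
    · rcases hkv : D.kind v with t | _ | _
      · rw [hk v t hkv]
        exact ho₃ v i t hkv
      · simp [hkv, Elementary.IsCrossing] at hv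
      · simp [hkv, Elementary.IsCrossing] at hv
  have farc : ∀ v i, o (v, i) = !b → f (v, (s v).arc i) = f (D.glue (v, i)) := by
    intro v i hi
    have hd := hf.1 (D.glue (v, i))
    rw [D.glue_glue] at hd
    rw [← hd]
    dsimp only
    rcases hkv : D.kind v with t | _ | _
    · rw [hk v t hkv]; rfl
    all_goals
      have hov : ∀ i, o (v, i) = (D.kind v).isOver i :=
        fun i => ho₂ v i (by simp [hkv, Elementary.IsCrossing])
      have h0 := fun i => hf.2 (v, i)
      have hv := hK v
      simp only [badCrossings, Finset.mem_filter, Finset.mem_univ, true_and] at hv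
      rw [hov] at hi
      simp only [hov] at h0
      have h00 := h0 0
      have h01 := h0 1
      have h02 := h0 2
      have h03 := h0 3
      rw [hkv] at hv hi h00 h01 h02 h03
      clear h0 hd
      cases hsv : s v <;> cases b <;> rw [hsv] at hv <;> fin_cases i <;>
        simp_all [endDifference_apply, Elementary.turn, Smoothing.arc, Elementary.isOver, Elementary.isA,
          Elementary.isB] <;> linarith
  -- An end without the label `b` takes the value at the other end of its edge, which has that
  -- label.
  have hconst := (D.circlesOfState_le_one_iff s).1 hs
    (fun d => if o d = b then f d else f (D.glue d)) ?_ ?_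
  · rcases isEmpty_or_nonempty D.Dart with hE | ⟨⟨d₀⟩⟩
    · rw [Subsingleton.elim f 0]; exact zero_mem _
    refine Submodule.mem_span_singleton.2
      ⟨if o d₀ = b then f d₀ else f (D.glue d₀), ?_⟩
    ext d
    by_cases hd : o d = b
    · have := hconst d₀ d
      simp only [hd, if_true] at this
      simp [hd, this]
    · simp [hd, hf.2 d hd]
  · intro d
    simp only [ho₁, D.glue_glue]
    cases o d <;> cases b <;> simp
  · intro v i
    simp only [oarc]
    by_cases hi : o (v, i) = b
    · have := farc v ((s v).arc i) (by rw [oarc, hi])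
      rw [Smoothing.arc_arc] at this
      simp [hi, this]
    · have hi' : o (v, i) = !b := by revert hi; cases o (v, i) <;> cases b <;> simp
      simp [hi', farc v i hi']

/-- In a planar alternating diagram the states with a single circle all have the same numbers
of `A`- and `B`-smoothings. -/
theorem card_badCrossings [Nonempty D.V] (hD : D.Planar) {o : D.Dart → Bool}
    (ho₁ : ∀ d, o (D.glue d) = !o d)
    (ho₂ : ∀ v i, (D.kind v).IsCrossing → o (v, i) = (D.kind v).isOver i)
    (ho₃ : ∀ v i s, D.kind v = .smoothed s → o (v, s.arc i) = !o (v, i))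
    (s : D.V → Smoothing) (hs : D.circlesOfState s ≤ 1)
    (hk : ∀ v t, D.kind v = .smoothed t → s v = t) (b : Bool) :
    finrank ℚ (D.coloredFaceFunctions o b) = 1 + (D.badCrossings s b).card := by
  classical
  have h₁ := D.card_add_two_le_finrank_faceFunctions hD
  have h₂ := finrank_faceFunctions_le ho₁ ho₂ ho₃
  have h₃ := finrank_coloredFaceFunctions_le ho₁ ho₂ ho₃ s hs hk
  have h₄ : (D.badCrossings s true).card + (D.badCrossings s false).card +
      (Finset.univ.filter fun v => ¬ (D.kind v).IsCrossing).card = Fintype.card D.V := by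
    rw [← Finset.card_union_of_disjoint, ← Finset.card_union_of_disjoint, ← Finset.card_univ]
    · congr 1
      ext v
      cases hkv : D.kind v <;> cases hsv : s v <;>
        simp only [badCrossings, Finset.mem_union, Finset.mem_filter, Finset.mem_univ, true_and,
          hkv, hsv, cond_true, cond_false] <;>
        simp [Elementary.isA, Elementary.isB, Elementary.IsCrossing]
    all_goals
      rw [Finset.disjoint_left]
      intro v
      cases hkv : D.kind v <;> cases hsv : s v <;>
        simp only [badCrossings, Finset.mem_union, Finset.mem_filter, Finset.mem_univ, true_and,
          hkv, hsv, cond_true, cond_false] <;>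
        simp [Elementary.isA, Elementary.isB, Elementary.IsCrossing]
  have ht := h₃ true
  have hf := h₃ false
  -- The upper bounds for the two colours add up to the lower bound from planarity, so neither is
  -- strict.
  cases b <;> omega

/-- In a planar alternating diagram the states with a single circle all contribute the same
power of `A` to the Kauffman bracket. -/
theorem Alternating.exists_weight [Nonempty D.V] (hD : D.Planar) (hA : D.Alternating) {A : ℂ}
    (hA₁ : ‖A‖ = 1) :
    ∃ W : ℂ, ‖W‖ = 1 ∧ ∀ s, D.circlesOfState s ≤ 1 →
      (∀ v t, D.kind v = .smoothed t → s v = t) → ∏ v, (D.kind v).weight A (s v) = W := by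
  obtain ⟨o, ho₁, ho₂, ho₃⟩ := hA
  -- The exponents, the numbers of faces of each colour minus one, are the numbers of `B`- and
  -- `A`-smoothings.
  refine ⟨A⁻¹ ^ (finrank ℚ (D.coloredFaceFunctions o true) - 1) *
    A ^ (finrank ℚ (D.coloredFaceFunctions o false) - 1), by simp [hA₁], fun s hs hk => ?_⟩
  rw [card_badCrossings hD ho₁ ho₂ ho₃ s hs hk, card_badCrossings hD ho₁ ho₂ ho₃ s hs hk,
    Nat.add_sub_cancel_left, Nat.add_sub_cancel_left]
  simp only [Elementary.weight_eq A _ _ (hk _), Finset.prod_mul_distrib, Finset.prod_ite,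
    Finset.prod_const, one_pow, mul_one, badCrossings, cond_true, cond_false]

end LinkDiagram
end

noncomputable section
/-! ### Twisting and state sums -/

theorem Smoothing.arc_zero_apply : Smoothing.zero.arc 0 = 3 ∧ Smoothing.zero.arc 1 = 2 ∧
    Smoothing.zero.arc 2 = 1 ∧ Smoothing.zero.arc 3 = 0 := by decide

theorem Smoothing.arc_infty_apply : Smoothing.infty.arc 0 = 1 ∧ Smoothing.infty.arc 1 = 0 ∧
    Smoothing.infty.arc 2 = 3 ∧ Smoothing.infty.arc 3 = 2 := by decide

namespace LinkDiagram

variable (D : LinkDiagram)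

/-- The result of adding two smoothings in a direction, up to a possible circle. -/
def Direction.add : Direction → Smoothing → Smoothing → Smoothing
  | .horizontal, .zero, .zero => .zero
  | .horizontal, _, _ => .infty
  | .vertical, .infty, .infty => .infty
  | .vertical, _, _ => .zero

/-- Adding two smoothings in a direction creates a circle. -/
def Direction.HasCircle : Direction → Smoothing → Smoothing → Prop
  | .horizontal, .infty, .infty => True
  | .vertical, .zero, .zero => True
  | _, _, _ => False

/-- Of the two ends at which a new crossing takes the place of the old one, the one
different from the end `2`. -/
def Direction.freeEnd : Direction → Fin 4
  | .horizontal => 3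
  | .vertical => 1

/-- The smoothing with the arcs along which a new crossing is joined to the old one. -/
def Direction.joint : Direction → Smoothing
  | .horizontal => .zero
  | .vertical => .infty

/-- The diagram `D.twist c r`, described uniformly for both directions. -/
def twisted (c : D.V) (r : Direction) : LinkDiagram :=
  (D.addVertex r.joint (D.kind c)).reattach
    (Equiv.swap ((some c : Option D.V), r.freeEnd) (none, r.freeEnd) *
      Equiv.swap ((some c : Option D.V), (2 : Fin 4)) (none, 2))

/-- The values of a function at the ends of a twisted diagram which are glued like in `D`. -/
def outerValues (c : D.V) (r : Direction) (f : Option D.V × Fin 4 → ℚ) : D.Dart → ℚ :=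
  fun e => if e.1 = c ∧ (e.2 = r.freeEnd ∨ e.2 = 2) then f (none, e.2) else f (some e.1, e.2)

/-- Invariance under the gluing of `D.twisted c r`, in terms of the values at the four ends of the
old and the new crossing. -/
theorem twisted_invariant_iff (c : D.V) (r : Direction) (f : Option D.V × Fin 4 → ℚ) :
    (∀ d, f ((D.twisted c r).glue d) = f d) ↔
      f (none, r.joint.arc r.freeEnd) = f (some c, r.freeEnd) ∧
      f (none, r.joint.arc 2) = f (some c, 2) ∧
      ∀ d : D.Dart,
        D.outerValues c r f (D.glue d) =
        D.outerValues c r f d := by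
  set τ : Equiv.Perm (Option D.V × Fin 4) :=
    Equiv.swap ((some c : Option D.V), r.freeEnd) (none, r.freeEnd) *
        Equiv.swap ((some c : Option D.V), (2 : Fin 4)) (none, 2) with hτ
  have h2 : r.freeEnd ≠ 2 := by cases r <;> decide
  have hτn : ∀ i, τ (none, i) = if i = r.freeEnd ∨ i = 2 then (some c, i) else (none, i) := by
    intro i
    by_cases hi : i = 2
    · subst hi
      simp [hτ, Equiv.swap_apply_def, h2.symm]
    · by_cases hp : i = r.freeEnd <;> simp [hτ, Equiv.swap_apply_def, hi, hp, h2]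
  have hτs : ∀ v i, τ (some v, i) =
      if v = c ∧ (i = r.freeEnd ∨ i = 2) then (none, i) else (some v, i) := by
    intro v i
    by_cases hv : v = c
    · by_cases hi : i = 2
      · subst hi
        simp [hτ, Equiv.swap_apply_def, h2.symm, hv]
      · by_cases hp : i = r.freeEnd <;> simp [hτ, Equiv.swap_apply_def, hi, hp, hv, h2]
    · simp [hτ, Equiv.swap_apply_def, hv]
  have hτf : ∀ d : D.Dart, f (τ (some d.1, d.2)) =
      D.outerValues c r f d := by
    intro d
    rw [hτs]
    dsimp only [outerValues]
    split_ifs <;> rfl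
  -- Invariance of `f` under a conjugate by `τ` is invariance of `f ∘ τ` under the original gluing.
  have h₁ : (∀ d, f ((D.twisted c r).glue d) = f d) ↔
      ∀ d, f (τ ((D.addVertex r.joint (D.kind c)).glue d)) = f (τ d) := by
    change (∀ d : Option D.V × Fin 4,
      f (τ ((D.addVertex r.joint (D.kind c)).glue (τ⁻¹ d))) = f d) ↔ _
    exact ⟨fun h d => (congrArg (fun x => f (τ ((D.addVertex r.joint (D.kind c)).glue x)))
        (τ.symm_apply_apply d)).symm.trans (h (τ d)),
      fun h d => (h (τ⁻¹ d)).trans (congrArg f (τ.apply_symm_apply d))⟩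
  have h₂ : (∀ d, f (τ ((D.addVertex r.joint (D.kind c)).glue d)) = f (τ d)) ↔
      (∀ i, f (τ (none, r.joint.arc i)) = f (τ (none, i))) ∧
      ∀ d : D.Dart, f (τ (some (D.glue d).1, (D.glue d).2)) = f (τ (some d.1, d.2)) := by
    constructor
    · exact fun h => ⟨fun i => h (none, i), fun d => h (some d.1, d.2)⟩
    · rintro ⟨h, h'⟩ ⟨_ | v, i⟩
      · exact h i
      · exact h' (v, i)
  rw [h₁, h₂, ← and_assoc]
  refine and_congr ?_ (forall_congr' fun d => by rw [hτf, hτf])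
  simp only [hτn]
  -- One arc of `r.joint` ends at `r.freeEnd`, the other at `2`, so these two equations suffice.
  cases r
  · constructor
    · intro h
      exact ⟨by simpa [Direction.joint, Direction.freeEnd, Smoothing.arc] using h 3,
        by simpa [Direction.joint, Direction.freeEnd, Smoothing.arc] using h 2⟩
    · rintro ⟨ha, hb⟩ i
      fin_cases i <;>
        simp_all [Direction.joint, Direction.freeEnd, Smoothing.arc]
  · constructor
    · intro h
      exact ⟨by simpa [Direction.joint, Direction.freeEnd, Smoothing.arc] using h 1,
        by simpa [Direction.joint, Direction.freeEnd, Smoothing.arc] using h 2⟩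
    · rintro ⟨ha, hb⟩ i
      fin_cases i <;>
        simp_all [Direction.joint, Direction.freeEnd, Smoothing.arc]

/-! ### States with a single circle before and after a twist -/

theorem twisted_circlesOfState_le_one_iff_forall (c : D.V) (r : Direction)
    (s : Option D.V → Smoothing) :
    (D.twisted c r).circlesOfState s ≤ 1 ↔ ∀ f : Option D.V × Fin 4 → ℚ,
      f (none, r.joint.arc r.freeEnd) = f (some c, r.freeEnd) →
      f (none, r.joint.arc 2) = f (some c, 2) →
      (∀ d : D.Dart,
        D.outerValues c r f (D.glue d) =
        D.outerValues c r f d) →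
      (∀ i, f (none, (s none).arc i) = f (none, i)) →
      (∀ i, f (some c, (s (some c)).arc i) = f (some c, i)) →
      (∀ v i, v ≠ c → f (some v, (s (some v)).arc i) = f (some v, i)) → ∀ x y, f x = f y := by
  refine ((D.twisted c r).circlesOfState_le_one_iff s).trans ?_
  change (∀ f : Option D.V × Fin 4 → ℚ, (∀ d, f ((D.twisted c r).glue d) = f d) →
    (∀ (v : Option D.V) i, f (v, (s v).arc i) = f (v, i)) → ∀ x y, f x = f y) ↔ _
  simp only [twisted_invariant_iff]
  refine forall_congr' fun f => ⟨fun h h₁ h₂ h₃ h₄ h₅ h₆ => h ⟨h₁, h₂, h₃⟩ ?_,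
    fun h h₁ h₂ => h h₁.1 h₁.2.1 h₁.2.2 (h₂ _) (h₂ _) fun v i _ => h₂ _ i⟩
  rintro (_ | v) i
  · exact h₄ i
  · by_cases hv : v = c
    · rw [hv]; exact h₅ i
    · exact h₆ v i hv

/-- The circle between the two crossings misses the end `0` of the old one, so it is not the only
circle. -/
theorem not_hasCircle_of_twisted (c : D.V) (r : Direction) (s : Option D.V → Smoothing)
    (h : (D.twisted c r).circlesOfState s ≤ 1) : ¬ r.HasCircle (s (some c)) (s none) := by
  intro hcirc
  have z := Smoothing.arc_zero_apply
  have w := Smoothing.arc_infty_apply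
  rw [twisted_circlesOfState_le_one_iff_forall] at h
  have harc : ∀ i, (((s (some c)).arc i = r.freeEnd ∨ (s (some c)).arc i = 2) ↔
      (i = r.freeEnd ∨ i = 2)) ∧ (((s none).arc i = r.freeEnd ∨ (s none).arc i = 2) ↔
      (i = r.freeEnd ∨ i = 2)) := by
    clear h
    generalize s none = b at *
    generalize s (some c) = a at *
    cases r <;> cases b <;> cases a <;> first | exact hcirc.elim | decide
  -- The indicator function of that circle, which consists of the ends of the two crossings facing
  -- each other.
  have := h (fun e => if e.1 = some c ∧ (e.2 = r.freeEnd ∨ e.2 = 2) ∨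
    e.1 = none ∧ ¬ (e.2 = r.freeEnd ∨ e.2 = 2) then 1 else 0)
    (by cases r <;> simp [Direction.joint, Direction.freeEnd, z, w])
    (by cases r <;> simp [Direction.joint, Direction.freeEnd, z, w])
    (by
      intro d
      have h₀ : ∀ d, D.outerValues c r (fun e : Option D.V × Fin 4 =>
          if e.1 = some c ∧ (e.2 = r.freeEnd ∨ e.2 = 2) ∨
            e.1 = none ∧ ¬ (e.2 = r.freeEnd ∨ e.2 = 2) then 1 else 0) d = 0 := by
        intro d
        dsimp only [outerValues]
        split_ifs <;> simp_all
      rw [h₀, h₀])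
    (fun i => by simp only [(harc i).2])
    (fun i => by simp only [(harc i).1])
    (fun v i hv => by simp [hv])
    (some c, 2) (some c, 0)
  cases r <;> simp [Direction.freeEnd] at this

/-- Given values at the ends of the sum of two smoothings, the second of which is `b`, the values
at the ends of the first. -/
def Direction.oldValues (r : Direction) (b : Smoothing) (g : Fin 4 → ℚ) (i : Fin 4) : ℚ :=
  if (i = r.freeEnd ∨ i = 2) ∧ b ≠ r.joint then g (r.joint.arc i) else g i

/-- Given values at the ends of the sum of two smoothings, the second of which is `b`, the values
at the ends of the second. -/
def Direction.newValues (r : Direction) (b : Smoothing) (g : Fin 4 → ℚ) (i : Fin 4) : ℚ :=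
  if i = r.freeEnd ∨ i = 2 then g i else r.oldValues b g (r.joint.arc i)

/-- If `b` is the joint, the inner ends of `a` continue through it to the outer ends. Otherwise `b`
turns back, and without a circle `a` is the joint, so the inner ends get their values along its
arcs. -/
theorem Direction.oldValues_arc (r : Direction) (a b : Smoothing) (h : ¬ r.HasCircle a b)
    (g : Fin 4 → ℚ) (hg : ∀ i, g ((r.add a b).arc i) = g i) (i : Fin 4) :
    r.oldValues b g (a.arc i) = r.oldValues b g i := by
  have z := Smoothing.arc_zero_apply
  have w := Smoothing.arc_infty_apply
  have h0 := hg 0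
  have h1 := hg 1
  have h2 := hg 2
  cases r <;> cases b <;> cases a <;>
    simp only [Direction.HasCircle, Direction.add, z, w, not_true_eq_false] at h h0 h1 h2 <;>
    fin_cases i <;> simp [oldValues, freeEnd, joint, z, w] <;> linarith

theorem Direction.newValues_arc (r : Direction) (a b : Smoothing) (h : ¬ r.HasCircle a b)
    (g : Fin 4 → ℚ) (hg : ∀ i, g ((r.add a b).arc i) = g i) (i : Fin 4) :
    r.newValues b g (b.arc i) = r.newValues b g i := by
  have z := Smoothing.arc_zero_apply
  have w := Smoothing.arc_infty_apply
  have h0 := hg 0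
  have h1 := hg 1
  have h2 := hg 2
  cases r <;> cases b <;> cases a <;>
    simp only [Direction.HasCircle, Direction.add, z, w, not_true_eq_false] at h h0 h1 h2 <;>
    fin_cases i <;> simp [newValues, oldValues, freeEnd, joint, z, w] <;> linarith

theorem Direction.newValues_joint (r : Direction) (b : Smoothing) (g : Fin 4 → ℚ) :
    r.newValues b g (r.joint.arc r.freeEnd) = r.oldValues b g r.freeEnd ∧
      r.newValues b g (r.joint.arc 2) = r.oldValues b g 2 := by
  cases r <;> simp [newValues, freeEnd, joint, Smoothing.arc_zero_apply, Smoothing.arc_infty_apply]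

/-- An invariant function on `D` extends to the twist by `oldValues` and `newValues`, where it must
be constant. -/
theorem circlesOfState_le_one_of_twisted (c : D.V) (r : Direction) (s : Option D.V → Smoothing)
    (h : (D.twisted c r).circlesOfState s ≤ 1) :
    D.circlesOfState (Function.update (fun v => s (some v)) c (r.add (s (some c)) (s none)))
        ≤ 1 := by
  have hcirc := D.not_hasCircle_of_twisted c r s h
  rw [D.circlesOfState_le_one_iff]
  rw [twisted_circlesOfState_le_one_iff_forall] at h
  intro f hf hfs x y
  have hc := hfs c
  simp only [Function.update_self] at hc
  set g : Fin 4 → ℚ := fun i => f (c, i) with hg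
  set F : Option D.V × Fin 4 → ℚ := fun e => e.1.elim (r.newValues (s none) g e.2)
    (fun v => if v = c then r.oldValues (s none) g e.2 else f (v, e.2)) with hF
  have hFn : ∀ i, F (none, i) = r.newValues (s none) g i := fun i => rfl
  have hFc : ∀ i, F (some c, i) = r.oldValues (s none) g i := fun i => if_pos rfl
  have hFv : ∀ v i, v ≠ c → F (some v, i) = f (v, i) := fun v i hv => if_neg hv
  have hFf : D.outerValues c r F = f := by
    ext ⟨v, i⟩
    by_cases hv : v = c
    · subst hv
      simp only [outerValues, hFn, hFc, true_and]
      split_ifs with hi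
      · simp [Direction.newValues, hi, g]
      · simp [Direction.oldValues, hi, g]
    · simp [outerValues, hv, hFv]
  have hconst := h F
    (by rw [hFn, hFc, (r.newValues_joint _ _).1])
    (by rw [hFn, hFc, (r.newValues_joint _ _).2])
    (by rw [hFf]; exact hf)
    (fun i => r.newValues_arc _ _ hcirc g hc i)
    (fun i => by rw [hFc, hFc, r.oldValues_arc _ _ hcirc g hc i])
    (by
      intro v i hv
      have := hfs v i
      rw [Function.update_of_ne hv] at this
      rw [hFv v _ hv, hFv v _ hv, this])
  rw [← hFf]
  dsimp only [outerValues]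
  split_ifs <;> exact hconst _ _

theorem outerValues_of_ne (c : D.V) (r : Direction) (f : Option D.V × Fin 4 → ℚ) (v : D.V)
    (hv : v ≠ c) (i : Fin 4) : D.outerValues c r f (v, i) = f (some v, i) := by
  simp [outerValues, hv]

theorem outerValues_self (c : D.V) (r : Direction) (f : Option D.V × Fin 4 → ℚ) (i : Fin 4) :
    D.outerValues c r f (c, i) =
      if i = r.freeEnd ∨ i = 2 then f (none, i) else f (some c, i) := by
  simp [outerValues]

theorem Direction.add_arc_of_arc (r : Direction) (a b : Smoothing) (h : ¬ r.HasCircle a b)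
    (n m : Fin 4 → ℚ) (hp : n (r.joint.arc r.freeEnd) = m r.freeEnd)
    (h2 : n (r.joint.arc 2) = m 2) (hn : ∀ i, n (b.arc i) = n i) (hm : ∀ i, m (a.arc i) = m i)
    (i : Fin 4) :
    (if (r.add a b).arc i = r.freeEnd ∨ (r.add a b).arc i = 2
      then n ((r.add a b).arc i) else m ((r.add a b).arc i)) =
      if i = r.freeEnd ∨ i = 2 then n i else m i := by
  have z := Smoothing.arc_zero_apply
  have w := Smoothing.arc_infty_apply
  have hn0 := hn 0
  have hn1 := hn 1
  have hn2 := hn 2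
  have hm0 := hm 0
  have hm1 := hm 1
  have hm2 := hm 2
  clear hn hm
  cases r <;> cases b <;> cases a <;>
    simp only [HasCircle, freeEnd, joint, z, w,
      not_true_eq_false] at h hm0 hm1 hm2 hn0 hn1 hn2 hp h2 <;>
    fin_cases i <;> simp [add, freeEnd, z, w] <;> linarith

/-- Without a circle every inner end is connected to an outer one. -/
theorem Direction.eq_of_outer (r : Direction) (a b : Smoothing) (h : ¬ r.HasCircle a b)
    (n m : Fin 4 → ℚ) (hp : n (r.joint.arc r.freeEnd) = m r.freeEnd)
    (h2 : n (r.joint.arc 2) = m 2) (hn : ∀ i, n (b.arc i) = n i) (hm : ∀ i, m (a.arc i) = m i)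
    (hout : ∀ i, (if i = r.freeEnd ∨ i = 2 then n i else m i) = m 0) (i : Fin 4) :
    n i = m 0 ∧ m i = m 0 := by
  have z := Smoothing.arc_zero_apply
  have w := Smoothing.arc_infty_apply
  have hn0 := hn 0
  have hn1 := hn 1
  have hn2 := hn 2
  have hm0 := hm 0
  have hm1 := hm 1
  have hm2 := hm 2
  have k1 := hout 1
  have k2 := hout 2
  have k3 := hout 3
  clear hn hm hout
  cases r <;> cases b <;> cases a <;>
    simp only [HasCircle, freeEnd, joint, z, w,
      not_true_eq_false] at h hm0 hm1 hm2 hn0 hn1 hn2 hp h2 <;>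
    simp [freeEnd] at k1 k2 k3 <;>
    fin_cases i <;> constructor <;> simp <;> linarith

theorem twisted_circlesOfState_le_one (c : D.V) (r : Direction) (s : Option D.V → Smoothing)
    (hcirc : ¬ r.HasCircle (s (some c)) (s none))
    (h : D.circlesOfState (Function.update (fun v => s (some v)) c (r.add (s (some c)) (s none)))
        ≤ 1) :
    (D.twisted c r).circlesOfState s ≤ 1 := by
  rw [D.circlesOfState_le_one_iff] at h
  rw [twisted_circlesOfState_le_one_iff_forall]
  intro f hp h2 hf hn hc hv
  have hconst := h (D.outerValues c r f) hf (by
    intro v i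
    by_cases hvc : v = c
    · rw [hvc, outerValues_self, outerValues_self, Function.update_self]
      exact r.add_arc_of_arc _ _ hcirc (fun i => f (none, i)) (fun i => f (some c, i)) hp h2 hn hc i
    · rw [outerValues_of_ne _ _ _ _ _ hvc, outerValues_of_ne _ _ _ _ _ hvc,
        Function.update_of_ne hvc, hv v i hvc])
  have h0 : D.outerValues c r f (c, 0) = f (some c, 0) := by
    rw [outerValues_self, if_neg (by cases r <;> decide)]
  have key := r.eq_of_outer _ _ hcirc (fun i => f (none, i)) (fun i => f (some c, i)) hp h2 hn hc
    (fun i => by rw [← outerValues_self, hconst (c, i) (c, 0), h0])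
  suffices hx : ∀ x, f x = f (some c, 0) from fun x y => (hx x).trans (hx y).symm
  rintro ⟨_ | v, i⟩
  · exact (key i).1
  · by_cases hv : v = c
    · rw [hv]; exact (key i).2
    · rw [← h0, ← D.outerValues_of_ne c r f v hv]
      exact hconst _ _

/-- The states with a single circle after a twist come from such states before the twist. -/
theorem twisted_circlesOfState_le_one_iff (c : D.V) (r : Direction) (s : Option D.V → Smoothing) :
    (D.twisted c r).circlesOfState s ≤ 1 ↔ ¬ r.HasCircle (s (some c)) (s none) ∧
      D.circlesOfState (Function.update (fun v => s (some v)) c (r.add (s (some c)) (s none)))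
        ≤ 1 :=
  ⟨fun h => ⟨D.not_hasCircle_of_twisted c r s h, D.circlesOfState_le_one_of_twisted c r s h⟩,
    fun h => D.twisted_circlesOfState_le_one c r s h.1 h.2⟩

end LinkDiagram
end

noncomputable section
/-! ### State sums at the root of unity of the determinant -/

theorem Elementary.weight_smoothed (A : ℂ) (t s : Smoothing) :
    (smoothed t).weight A s = if s = t then 1 else 0 := rfl

namespace LinkDiagram

variable (D : LinkDiagram)

/-- The sum over the states with a single circle, for arbitrary weights of the smoothings. -/
def stateSum (w : D.V → Smoothing → ℂ) : ℂ :=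
  ∑ s : D.V → Smoothing, (∏ v, w v (s v)) * if D.circlesOfState s ≤ 1 then 1 else 0

/-- The point `A` at which the determinant is evaluated. -/
def detRoot : ℂ := Complex.exp (Real.pi / 4 * Complex.I)

theorem norm_detRoot : ‖detRoot‖ = 1 := by
  have := Complex.norm_exp_ofReal_mul_I (Real.pi / 4)
  rwa [Complex.ofReal_div, Complex.ofReal_ofNat] at this

theorem detRoot_ne_zero : detRoot ≠ 0 := Complex.exp_ne_zero _

theorem detRoot_mul_self : detRoot * detRoot = Complex.I := by
  rw [detRoot, ← Complex.exp_add]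
  refine Eq.trans (congrArg Complex.exp ?_) Complex.exp_pi_div_two_mul_I
  ring

theorem inv_detRoot_mul_I : detRoot⁻¹ * Complex.I = detRoot := by
  rw [← detRoot_mul_self, inv_mul_cancel_left₀ detRoot_ne_zero]

theorem inv_detRoot_mul_self : detRoot⁻¹ * detRoot⁻¹ = -Complex.I := by
  rw [← mul_inv, detRoot_mul_self, Complex.inv_I]

theorem circleValue_detRoot : -detRoot ^ 2 - detRoot⁻¹ ^ 2 = 0 := by
  rw [sq, sq, detRoot_mul_self, inv_detRoot_mul_self]
  ring

/-- A circle has the value `0`, which kills all states with two or more circles. -/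
theorem kauffmanBracket_detRoot :
    D.kauffmanBracket detRoot = D.stateSum fun v => (D.kind v).weight detRoot := by
  rw [kauffmanBracket, stateSum]
  refine Finset.sum_congr rfl fun s _ => ?_
  -- With truncated subtraction `0 ^ (k - 1)` is `1` exactly for `k ≤ 1`, including `k = 0`.
  rw [circleValue_detRoot, zero_pow_eq]
  simp only [tsub_eq_zero_iff_le]

theorem det_eq : D.det = ‖D.stateSum fun v => (D.kind v).weight detRoot‖ := by
  rw [← kauffmanBracket_detRoot]; rfl

/-! ### State sums and the weights at a single vertex -/

theorem sum_smoothing (F : Smoothing → ℂ) : ∑ t, F t = F .zero + F .infty :=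
  Finset.sum_pair (by decide)

/-- A sum over all states, in terms of the smoothing at a vertex. -/
theorem sum_states {V : Type} [Fintype V] [DecidableEq V] (c : V)
    (F : (V → Smoothing) → ℂ) :
    ∑ s, F s = ∑ p : {v // v ≠ c} → Smoothing,
      (F ((Equiv.funSplitAt c Smoothing).symm (.zero, p)) +
        F ((Equiv.funSplitAt c Smoothing).symm (.infty, p))) := by
  rw [← Equiv.sum_comp (Equiv.funSplitAt c Smoothing).symm, Fintype.sum_prod_type,
    Finset.sum_add_distrib, sum_smoothing]

theorem prod_funSplitAt {V : Type} [Fintype V] [DecidableEq V] (c : V)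
    (w : V → Smoothing → ℂ) (t : Smoothing) (p : {v // v ≠ c} → Smoothing) :
    ∏ v, w v ((Equiv.funSplitAt c Smoothing).symm (t, p) v) =
      w c t * ∏ v : {v // v ≠ c}, w v (p v) := by
  rw [Fintype.prod_eq_mul_prod_subtype_ne _ c]
  congr 1
  · simp [Equiv.funSplitAt, Equiv.piSplitAt]
  · refine Finset.prod_congr rfl fun v _ => ?_
    simp [Equiv.funSplitAt, Equiv.piSplitAt, v.2]

theorem update_funSplitAt {V : Type} [DecidableEq V] (c : V) (t t' : Smoothing)
    (p : {v // v ≠ c} → Smoothing) :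
    Function.update ((Equiv.funSplitAt c Smoothing).symm (t, p)) c t' =
      (Equiv.funSplitAt c Smoothing).symm (t', p) := by
  ext v
  by_cases hv : v = c
  · subst hv; simp [Equiv.funSplitAt, Equiv.piSplitAt]
  · simp [Equiv.funSplitAt, Equiv.piSplitAt, hv]

theorem funSplitAt_self {V : Type} [DecidableEq V] (c : V) (t : Smoothing)
    (p : {v // v ≠ c} → Smoothing) :
    (Equiv.funSplitAt c Smoothing).symm (t, p) c = t := by
  simp [Equiv.funSplitAt, Equiv.piSplitAt]

theorem funSplitAt_of_ne {V : Type} [DecidableEq V] (c : V) (t : Smoothing)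
    (p : {v // v ≠ c} → Smoothing) {v : V} (hv : v ≠ c) :
    (Equiv.funSplitAt c Smoothing).symm (t, p) v = p ⟨v, hv⟩ := by
  simp [Equiv.funSplitAt, Equiv.piSplitAt, hv]

theorem stateSum_update (c : D.V) (w : D.V → Smoothing → ℂ) (u : Smoothing → ℂ) :
    D.stateSum (Function.update w c u) = ∑ p : {v // v ≠ c} → Smoothing,
      (∏ v : {v // v ≠ c}, w v (p v)) *
        (u .zero * (if D.circlesOfState ((Equiv.funSplitAt c Smoothing).symm (.zero, p)) ≤ 1
          then 1 else 0) +
        u .infty * (if D.circlesOfState ((Equiv.funSplitAt c Smoothing).symm (.infty, p)) ≤ 1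
          then 1 else 0)) := by
  rw [stateSum, sum_states c]
  refine Finset.sum_congr rfl fun p _ => ?_
  rw [prod_funSplitAt, prod_funSplitAt, Function.update_self]
  have : ∏ v : {v // v ≠ c}, Function.update w c u v (p v) = ∏ v : {v // v ≠ c}, w v (p v) :=
    Finset.prod_congr rfl fun v _ => by rw [Function.update_of_ne v.2]
  rw [this]
  ring

/-- The weights of the sum of two tangles in a direction, where a circle has the value `0`. -/
def Direction.addWeights : Direction → (Smoothing → ℂ) → (Smoothing → ℂ) → Smoothing → ℂ
  | .horizontal, u, u', .zero => u .zero * u' .zero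
  | .horizontal, u, u', .infty => u .zero * u' .infty + u .infty * u' .zero
  | .vertical, u, u', .zero => u .zero * u' .infty + u .infty * u' .zero
  | .vertical, u, u', .infty => u .infty * u' .infty

theorem Direction.addWeights_comm (r : Direction) (u u' : Smoothing → ℂ) :
    r.addWeights u u' = r.addWeights u' u := by
  ext t
  cases r <;> cases t <;> simp only [addWeights] <;> ring

/-- The states of the twist are grouped by the states they induce on `D`; the pair of smoothings
with a circle contributes nothing and is absent from `addWeights`. -/
theorem stateSum_twisted (c : D.V) (r : Direction) (w : Option D.V → Smoothing → ℂ) :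
    (D.twisted c r).stateSum w =
      D.stateSum (Function.update (fun v => w (some v)) c
        (r.addWeights (w (some c)) (w none))) := by
  classical
  rw [stateSum_update]
  change ∑ s : Option D.V → Smoothing, (∏ v : Option D.V, w v (s v)) *
    (if (D.twisted c r).circlesOfState s ≤ 1 then (1 : ℂ) else 0) = _
  simp only [D.twisted_circlesOfState_le_one_iff, Fintype.prod_option]
  rw [← Equiv.sum_comp (Equiv.piOptionEquivProd (β := fun _ => Smoothing)).symm,
    Fintype.sum_prod_type, Finset.sum_comm]
  rw [sum_states c]
  refine Finset.sum_congr rfl fun p _ => ?_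
  rw [sum_smoothing, sum_smoothing]
  simp only [Equiv.piOptionEquivProd_symm_apply]
  simp only [update_funSplitAt, funSplitAt_self, prod_funSplitAt c fun v => w (some v)]
  cases r <;> simp [Direction.HasCircle, Direction.add, Direction.addWeights] <;>
    split_ifs <;> ring

/-- The bracket of the diagram in which a vertex is smoothed. -/
def smoothedSum (c : D.V) (t : Smoothing) : ℂ :=
  D.stateSum (Function.update (fun v => (D.kind v).weight detRoot) c
    ((Elementary.smoothed t).weight detRoot))

/-- The skein relation: a state sum is linear in the weights at one vertex. -/
theorem stateSum_update_eq (c : D.V) (u : Smoothing → ℂ) :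
    D.stateSum (Function.update (fun v => (D.kind v).weight detRoot) c u) =
      u .zero * D.smoothedSum c .zero + u .infty * D.smoothedSum c .infty := by
  rw [smoothedSum, smoothedSum, stateSum_update, stateSum_update, stateSum_update,
    Finset.mul_sum, Finset.mul_sum, ← Finset.sum_add_distrib]
  refine Finset.sum_congr rfl fun p _ => ?_
  simp only [Elementary.weight, if_true, reduceCtorEq, if_false]
  ring

theorem det_setKind (c : D.V) (k : Elementary) :
    (D.setKind c k).det = ‖k.weight detRoot .zero * D.smoothedSum c .zero +
      k.weight detRoot .infty * D.smoothedSum c .infty‖ := by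
  rw [← stateSum_update_eq, det_eq]
  congr 1
  change D.stateSum (fun v => (Function.update D.kind c k v).weight detRoot) = _
  congr 1
  ext v t
  by_cases hv : v = c
  · subst hv; simp
  · simp [hv]

theorem det_smooth (c : D.V) (t : Smoothing) : (D.smooth c t).det = ‖D.smoothedSum c t‖ := by
  rw [smooth, det_setKind]
  cases t <;> simp [Elementary.weight]

theorem det_eq_norm_smoothedSum (c : D.V) :
    D.det = ‖(D.kind c).weight detRoot .zero * D.smoothedSum c .zero +
      (D.kind c).weight detRoot .infty * D.smoothedSum c .infty‖ := by
  rw [← det_setKind, setKind, Function.update_eq_self]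

theorem smoothedSum_twisted (c : D.V) (r : Direction) (x : Option D.V)
    (hx : x = some c ∨ x = none) (t : Smoothing) :
    (D.twisted c r).smoothedSum x t =
      r.addWeights ((Elementary.smoothed t).weight detRoot) ((D.kind c).weight detRoot) .zero *
        D.smoothedSum c .zero +
      r.addWeights ((Elementary.smoothed t).weight detRoot) ((D.kind c).weight detRoot) .infty *
        D.smoothedSum c .infty := by
  classical
  rw [← stateSum_update_eq]
  refine (D.stateSum_twisted c r _).trans ?_
  change D.stateSum (Function.update (fun v : D.V =>
    Function.update (fun v : Option D.V => (v.elim (D.kind c) D.kind).weight detRoot) x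
      ((Elementary.smoothed t).weight detRoot) (some v)) c (r.addWeights
      (Function.update (fun v : Option D.V => (v.elim (D.kind c) D.kind).weight detRoot) x
        ((Elementary.smoothed t).weight detRoot) (some c))
      (Function.update (fun v : Option D.V => (v.elim (D.kind c) D.kind).weight detRoot) x
        ((Elementary.smoothed t).weight detRoot) none))) = _
  congr 1
  rcases hx with rfl | rfl
  · ext v t'
    by_cases hv : v = c
    · subst hv; simp
    · simp [hv]
  · rw [r.addWeights_comm]
    ext v t'
    by_cases hv : v = c
    · subst hv; simp
    · simp [hv]

theorem crossingNumber_twisted (c : D.V) (hc : (D.kind c).IsCrossing) (r : Direction) :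
    (D.twisted c r).crossingNumber = D.crossingNumber + 1 := by
  have e : (D.twisted c r).Cr ≃ Option D.Cr :=
    { toFun := fun
        | ⟨none, _⟩ => none
        | ⟨some v, h⟩ => some ⟨v, h⟩
      invFun := fun
        | none => ⟨none, hc⟩
        | some v => ⟨some v.1, v.2⟩
      left_inv := by rintro ⟨_ | v, h⟩ <;> rfl
      right_inv := by rintro (_ | v) <;> rfl }
  rw [crossingNumber, Nat.card_congr e, Finite.card_option]
  rfl

/-! ### Rational extensions of coherent crossings -/

/-- A negative crossing which behaves like a crossing of an alternating diagram: the brackets of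
its smoothings have the absolute values `x` and `y` and contribute to the determinant with the
same phase. -/
def Coherent (D : LinkDiagram) (c : D.V) (x y : ℝ) : Prop :=
  D.kind c = .neg ∧ ∃ U : ℂ, ‖U‖ = 1 ∧ D.smoothedSum c .zero = U * x ∧
    D.smoothedSum c .infty = U * (Complex.I * y)

variable {D}

/-- Since `A⁻¹ i = A`, the contributions `A U x` and `A⁻¹ U i y` have the same phase. -/
theorem Coherent.det_eq {c : D.V} {x y : ℝ} (h : D.Coherent c x y) (hx : 0 ≤ x) (hy : 0 ≤ y) :
    D.det = x + y := by
  obtain ⟨hk, U, hU, h₀, h₁⟩ := h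
  rw [det_eq_norm_smoothedSum D c, hk, h₀, h₁]
  have : Elementary.neg.weight detRoot .zero * (U * x) +
      Elementary.neg.weight detRoot .infty * (U * (Complex.I * y)) =
      detRoot * U * ((x + y : ℝ) : ℂ) := by
    simp only [Elementary.weight]
    push_cast
    linear_combination (U * y) * inv_detRoot_mul_I
  rw [this, norm_mul, norm_mul, norm_detRoot, hU, Complex.norm_real, Real.norm_of_nonneg
    (add_nonneg hx hy)]
  ring

/-- Smoothing by `0` gives back `D`, hence `x + y`; smoothing by `∞` leaves a kink, which only
changes the phase. For a vertical twist the roles are exchanged. -/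
theorem Coherent.twisted_horizontal {c : D.V} {x y : ℝ} (h : D.Coherent c x y) :
    (D.twisted c .horizontal).Coherent (some c : Option D.V) (x + y) y := by
  obtain ⟨hk, U, hU, h₀, h₁⟩ := h
  refine ⟨hk, detRoot * U, by simp [norm_detRoot, hU], ?_, ?_⟩
  · rw [D.smoothedSum_twisted c _ _ (Or.inl rfl), hk, h₀, h₁]
    simp only [Elementary.weight, Direction.addWeights, if_true, reduceCtorEq, if_false]
    push_cast
    linear_combination (U * y) * inv_detRoot_mul_I
  · rw [D.smoothedSum_twisted c _ _ (Or.inl rfl), hk, h₀, h₁]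
    simp only [Elementary.weight, Direction.addWeights, if_true, reduceCtorEq, if_false]
    ring

theorem Coherent.twisted_vertical {c : D.V} {x y : ℝ} (h : D.Coherent c x y) :
    (D.twisted c .vertical).Coherent (some c : Option D.V) x (x + y) := by
  obtain ⟨hk, U, hU, h₀, h₁⟩ := h
  refine ⟨hk, detRoot⁻¹ * U, by simp [norm_detRoot, hU], ?_, ?_⟩
  · rw [D.smoothedSum_twisted c _ _ (Or.inl rfl), hk, h₀, h₁]
    simp only [Elementary.weight, Direction.addWeights, if_true, reduceCtorEq, if_false]
    ring
  · rw [D.smoothedSum_twisted c _ _ (Or.inl rfl), hk, h₀, h₁]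
    simp only [Elementary.weight, Direction.addWeights, if_true, reduceCtorEq, if_false]
    push_cast
    linear_combination -(U * x) * inv_detRoot_mul_I

/-- A coherent crossing, of a diagram which has at most as many crossings as its determinant, such
that twists increase the determinant by at least `1`. -/
def Bounded (p : Σ D : LinkDiagram, D.V) : Prop :=
  ∃ x y : ℝ, p.1.Coherent p.2 x y ∧ 1 ≤ x ∧ 1 ≤ y ∧ (p.1.crossingNumber : ℝ) ≤ x + y

theorem Bounded.crossingNumber_le_det {p : Σ D : LinkDiagram, D.V} (h : Bounded p) :
    (p.1.crossingNumber : ℝ) ≤ p.1.det := by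
  obtain ⟨x, y, h, hx, hy, hle⟩ := h
  rwa [h.det_eq (by linarith) (by linarith)]

/-- One more crossing is paid for by the `y` or `x` added to the determinant. -/
theorem Bounded.twistStep {p : Σ D : LinkDiagram, D.V} (h : Bounded p) (r : Direction) :
    Bounded (twistStep r p) := by
  obtain ⟨x, y, h, hx, hy, hle⟩ := h
  have hc : (p.1.kind p.2).IsCrossing := by rw [h.1]; trivial
  have hn : ((p.1.twisted p.2 r).crossingNumber : ℝ) = p.1.crossingNumber + 1 := by
    rw [crossingNumber_twisted _ _ hc]; push_cast; rfl
  cases r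
  · refine ⟨x + y, y, h.twisted_horizontal, by linarith, hy, ?_⟩
    change ((p.1.twisted p.2 .horizontal).crossingNumber : ℝ) ≤ _
    linarith
  · refine ⟨x, x + y, h.twisted_vertical, hx, by linarith, ?_⟩
    change ((p.1.twisted p.2 .vertical).crossingNumber : ℝ) ≤ _
    linarith

theorem Bounded.iterate_twistStep {p : Σ D : LinkDiagram, D.V} (h : Bounded p) (r : Direction)
    (n : ℕ) : Bounded ((LinkDiagram.twistStep r)^[n] p) := by
  induction n with
  | zero => exact h
  | succ n ih => rw [Function.iterate_succ_apply']; exact ih.twistStep r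

theorem Bounded.insertTangle {a : List ℕ} : ∀ {p : Σ D : LinkDiagram, D.V} (r : Direction),
    Bounded p → Bounded (insertTangle r a p) := by
  induction a with
  | nil => exact fun r h => h
  | cons n l ih =>
    intro p r h
    cases l with
    | nil => exact h.iterate_twistStep r _
    | cons m l => exact ih r.other (h.iterate_twistStep r _)

/-! ### Almost alternating diagrams -/

/-- The smoothings of a negative dealternator have real brackets with opposite phases. -/
theorem IsDealternator.exists_smoothedSum (hD : D.Planar) {c : D.V} (hc : D.kind c = .neg)
    (h : D.IsDealternator c) :
    ∃ (W : ℂ) (m n : ℕ), ‖W‖ = 1 ∧ D.smoothedSum c .zero = detRoot * W * m ∧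
      D.smoothedSum c .infty = detRoot⁻¹ * W * n := by
  classical
  have : Nonempty (D.crossingChange c).V := ⟨c⟩
  obtain ⟨W, hW, hs⟩ := h.2.exists_weight (D := D.crossingChange c) hD norm_detRoot
  have hkc : (D.crossingChange c).kind c = .pos := by
    simp [crossingChange, setKind, hc, Elementary.change]
  have hkv : ∀ v, v ≠ c → (D.crossingChange c).kind v = D.kind v := by
    intro v hv
    simp [crossingChange, setKind, hv]
  -- The other vertices contribute the common weight divided by that of the changed crossing. `N` is
  -- `1` on one-circle states which agree with the vertices already smoothed; all others contribute
  -- `0`.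
  obtain ⟨N, key⟩ : ∃ N : Smoothing → ({v // v ≠ c} → Smoothing) → ℕ, ∀ t p,
      (∏ v : {v // v ≠ c}, (D.kind v).weight detRoot (p v)) *
        (if D.circlesOfState ((Equiv.funSplitAt c Smoothing).symm (t, p)) ≤ 1
          then (1 : ℂ) else 0) =
      (Elementary.pos.weight detRoot t)⁻¹ * W * N t p := by
    refine ⟨fun t p => if D.circlesOfState ((Equiv.funSplitAt c Smoothing).symm (t, p)) ≤ 1 ∧
      ∀ v : {v // v ≠ c}, ∀ t', D.kind v = .smoothed t' → p v = t' then 1 else 0, fun t p => ?_⟩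
    dsimp only
    by_cases h₁ : D.circlesOfState ((Equiv.funSplitAt c Smoothing).symm (t, p)) ≤ 1
    swap
    · simp [h₁]
    by_cases h₂ : ∀ v : {v // v ≠ c}, ∀ t', D.kind v = .smoothed t' → p v = t'
    · have := hs ((Equiv.funSplitAt c Smoothing).symm (t, p)) h₁ (by
        intro v t' hv
        by_cases hvc : v = c
        · rw [hvc, hkc] at hv
          cases hv
        · rw [hkv v hvc] at hv
          exact (funSplitAt_of_ne c t p hvc).trans (h₂ ⟨v, hvc⟩ t' hv))
      have hprod := prod_funSplitAt c
        (fun v => ((D.crossingChange c).kind v).weight detRoot) t p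
      rw [if_pos h₁, if_pos ⟨h₁, h₂⟩, mul_one, Nat.cast_one, mul_one, ← this]
      refine Eq.trans ?_ (congrArg (fun z => (Elementary.pos.weight detRoot t)⁻¹ * z) hprod.symm)
      have hne : Elementary.pos.weight detRoot t ≠ 0 := by
        cases t <;> simp [Elementary.weight, detRoot_ne_zero]
      rw [hkc, inv_mul_cancel_left₀ hne]
      exact Finset.prod_congr rfl fun v _ => by rw [hkv v v.2]
    · rw [if_neg (show ¬ (_ ∧ _) from fun h => h₂ h.2), Nat.cast_zero, mul_zero]
      push Not at h₂
      obtain ⟨v, t', hv, hne⟩ := h₂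
      rw [Finset.prod_eq_zero (Finset.mem_univ v), zero_mul]
      rw [hv]
      simp [Elementary.weight, hne]
  refine ⟨W, ∑ p, N .zero p, ∑ p, N .infty p, hW, ?_, ?_⟩
  all_goals
    rw [smoothedSum, stateSum_update]
    simp only [Elementary.weight_smoothed, if_true, reduceCtorEq, if_false, zero_mul, one_mul,
      add_zero, zero_add, key]
    rw [← Finset.mul_sum, ← Nat.cast_sum]
    simp only [Elementary.weight, inv_inv]

/-- Of the two twists of a dealternator, the one which corresponds to the larger of the determinants
of the smoothings has coherent crossings. -/
theorem coherent_twisted {c : D.V} (hc : D.kind c = .neg) {W : ℂ} (hW : ‖W‖ = 1) {m n : ℕ}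
    (h₀ : D.smoothedSum c .zero = detRoot * W * m)
    (h₁ : D.smoothedSum c .infty = detRoot⁻¹ * W * n) (x : Option D.V)
    (hx : x = some c ∨ x = none) :
    (D.twisted c .vertical).Coherent x m (m - n) ∧
      (D.twisted c .horizontal).Coherent x (n - m) n := by
  have hk : ∀ r, (D.twisted c r).kind x = .neg := by
    intro r
    rcases hx with rfl | rfl <;> exact hc
  have hA := mul_inv_cancel₀ detRoot_ne_zero
  -- Vertically, smoothing by `∞` gives back `D`, of bracket `i W (m - n)`; horizontally, smoothing
  -- by `0` does, and `U = -i W` writes this as `U (n - m)`.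
  refine ⟨⟨hk _, W, hW, ?_, ?_⟩, ⟨hk _, -Complex.I * W, by simp [hW], ?_, ?_⟩⟩
  all_goals
    rw [D.smoothedSum_twisted c _ x hx, hc, h₀, h₁]
    simp only [Elementary.weight, Direction.addWeights, if_true, reduceCtorEq, if_false]
    push_cast
  · linear_combination (W * m) * hA
  · linear_combination (W * m) * detRoot_mul_self + (W * n) * inv_detRoot_mul_self
  · linear_combination (W * m) * detRoot_mul_self + (W * n) * inv_detRoot_mul_self
  · linear_combination (W * n) * hA + (W * n) * Complex.I_mul_I

theorem Bounded.rationalExtension {E : LinkDiagram} {x : E.V} (h : Bounded ⟨E, x⟩) (a : List ℕ) :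
    ((E.rationalExtension x a).crossingNumber : ℝ) ≤ (E.rationalExtension x a).det :=
  (h.insertTangle (a := a) .horizontal).crossingNumber_le_det

end LinkDiagram
end

/-! ### The bound for extensions of a dealternator -/

theorem mainTheorem12 (D : LinkDiagram) (hD : D.Planar) (c : D.V) (hc : D.kind c = .neg)
    (hdealt : D.IsDealternator c) (hQ : D.QuasiAlternating)
    (hle : (D.crossingNumber : ℝ) ≤ D.det) :
    (D.smooth c .zero).det ≠ (D.smooth c .infty).det ∧
    ∀ r : LinkDiagram.Direction,
      (r = .vertical ∧ (D.smooth c .infty).det < (D.smooth c .zero).det ∨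
        r = .horizontal ∧ (D.smooth c .zero).det < (D.smooth c .infty).det) →
      ∀ x : (D.twist c r).V, (x = D.oldCrossing c r ∨ x = D.newCrossing c r) →
      ∀ a : List ℕ, LinkDiagram.IsExtensionTuple a →
        (((D.twist c r).rationalExtension x a).crossingNumber : ℝ) ≤
          ((D.twist c r).rationalExtension x a).det := by
  obtain ⟨W, m, n, hW, h₀, h₁⟩ := hdealt.exists_smoothedSum hD hc
  have hm : (D.smooth c .zero).det = m := by
    simp [LinkDiagram.det_smooth, h₀, LinkDiagram.norm_detRoot, hW]
  have hn : (D.smooth c .infty).det = n := by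
    simp [LinkDiagram.det_smooth, h₁, LinkDiagram.norm_detRoot, hW]
  -- The two smoothings contribute with opposite phases, so their determinants subtract.
  have hdet : D.det = |(m : ℝ) - n| := by
    have : LinkDiagram.detRoot * (LinkDiagram.detRoot * W * m) +
        LinkDiagram.detRoot⁻¹ * (LinkDiagram.detRoot⁻¹ * W * n) =
        Complex.I * W * ((m - n : ℝ) : ℂ) := by
      push_cast
      linear_combination (W * m) * LinkDiagram.detRoot_mul_self +
        (W * n) * LinkDiagram.inv_detRoot_mul_self
    rw [D.det_eq_norm_smoothedSum c, hc, h₀, h₁]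
    simp only [Elementary.weight]
    rw [this, norm_mul, norm_mul, Complex.norm_I, hW, Complex.norm_real, Real.norm_eq_abs]
    ring
  have hcr : (D.kind c).IsCrossing := hdealt.1
  have hpos : (1 : ℝ) ≤ D.crossingNumber := by
    have : Nonempty D.Cr := ⟨⟨c, hcr⟩⟩
    exact_mod_cast Nat.card_pos (α := D.Cr)
  rw [hdet] at hle
  rw [hm, hn]
  have hm₀ : (0 : ℝ) ≤ m := m.cast_nonneg
  have hn₀ : (0 : ℝ) ≤ n := n.cast_nonneg
  refine ⟨fun h => ?_, ?_⟩
  · rw [h, sub_self, abs_zero] at hle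
    linarith
  rintro r hr x hx a -
  have hnum : ((D.twisted c r).crossingNumber : ℝ) = D.crossingNumber + 1 := by
    rw [D.crossingNumber_twisted c hcr]; push_cast; rfl
  rcases hr with ⟨rfl, hlt⟩ | ⟨rfl, hlt⟩
  -- Now `1 ≤ c(D) ≤ m - n ≤ m`, so `c(D) + 1 ≤ m + (m - n)`; the other case is symmetric.
  · rw [abs_of_pos (by linarith)] at hle
    refine LinkDiagram.Bounded.rationalExtension
      ⟨m, m - n, (LinkDiagram.coherent_twisted hc hW h₀ h₁ x hx).1, ?_, ?_, hnum.trans_le ?_⟩ a <;>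
      linarith
  · rw [abs_of_neg (by linarith)] at hle
    refine LinkDiagram.Bounded.rationalExtension
      ⟨n - m, n, (LinkDiagram.coherent_twisted hc hW h₀ h₁ x hx).2, ?_, ?_, hnum.trans_le ?_⟩ a <;>
      linarith
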